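/- \textbf{Theorem.} Let $N\ge 13$ be an odd integer, let $L\ge 16$ be a power of two, and let $M\ge LN$ be a power of two. Write $\omega_n=e^{2\pi\sqrt{-1}/n}$, let $\lfloor x\rceil$ denote the integer nearest to $x$ (ties rounded up), and let $|0\rangle,\dots,|n-1\rangle$ be the standard orthonormal basis of $\mathbb{C}^n$. Let $F_n$ be the linear map on $\mathbb{C}^n$ with $F_n|i\rangle=\frac1{\sqrt n}\sum_{s=0}^{n-1}\omega_n^{is}|s\rangle$. Put $\alpha=\lfloor \frac{M}{2N}+\frac12\rfloor$. For $k\in\{0,\dots,M-1\}$ put $k'=\lfloor kN/M\rceil$, $t=k-\lfloor k'M/N\rceil$ and $s=k'\bmod N\in\{0,\dots,N-1\}$; then $-\alpha\le t\le\alpha$. Let $\Delta:\mathbb{C}^M\to\mathbb{C}^N\otimes\mathbb{C}^{2\alpha+1}$ be the linear map with $\Delta|k\rangle=|s\rangle|t+\alpha\rangle$. For a unit vector $|u\rangle=\sum_{i=0}^{N-1}u_i|i\rangle\in\mathbb{C}^N$, the odd cyclic quantum Fourier transform algorithm starts from $|u\rangle|0\rangle\in\mathbb{C}^N\otimes\mathbb{C}^L$,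 applies $F_L$ to the second register, then the linear map $|i\rangle|j\rangle\mapsto|i+jN\rangle\in\mathbb{C}^M$, then $F_M$, then $\Delta$. Its output is $$|v\rangle=\Delta F_M\Big(\frac1{\sqrt L}\sum_{i=0}^{N-1}\sum_{j=0}^{L-1}u_i|i+jN\rangle\Big)\in\mathbb{C}^N\otimes\mathbb{C}^{2\alpha+1}.$$ Let $\Lambda$ be the set of integers $t$ with $|t|\le\lfloor\frac{M}{2N}-\frac12\rfloor$ and let $A^0_t=\frac1{\sqrt{LMN}}\sum_{a=0}^{LN-1}\omega_M^{at}$. Then for every unit vector $|u\rangle\in\mathbb{C}^N$, $$\Big\||v\rangle-F_N|u\rangle\otimes\sum_{t\in\Lambda}A^0_t|t+\alpha\rangle\Big\|\le\frac2\pi\sqrt{\frac{22\ln^2N}{L}+\frac{32N^2}{LM}}+\frac{\pi LN}{M\sqrt3}.$$ -/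

import Mathlib

open scoped TensorProduct

noncomputable section

namespace OddQFT

/-- The state space `ℂⁿ` of a quantum register with basis states `|0⟩, …, |n-1⟩`, with the
Hermitian (`ℓ²`) norm. -/
abbrev Reg (n : ℕ) : Type := EuclideanSpace ℂ (Fin n)

/-- The basis state `|a⟩` of a register of dimension `n`, for `0 ≤ a < n`. The label is an integer
so that integer arithmetic can be done inside the ket; labels outside `{0, …, n-1}` (which do not
occur in the algorithm, see `delta_range` and `mul_range`) give the vector `0`. -/
def ket (n : ℕ) (a : ℤ) : Reg n :=
  WithLp.toLp 2 fun j : Fin n => if (j : ℤ) = a then 1 else 0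

/-- The linear map sending the basis state `|k⟩` to `f k`. -/
def linExt {n : ℕ} {E : Type*} [AddCommGroup E] [Module ℂ E] (f : Fin n → E) :
    Reg n →ₗ[ℂ] E :=
  (EuclideanSpace.basisFun (Fin n) ℂ).toBasis.constr ℂ f

/-- The root of unity `ω_n = e^{2π√-1/n}`. -/
def omega (n : ℕ) : ℂ := Complex.exp (2 * (Real.pi : ℂ) * Complex.I / (n : ℂ))

/-- The quantum Fourier transform `F_n`:
`|i⟩ ↦ (1/√n) ∑_{s=0}^{n-1} ω_n^{i s} |s⟩`, extended linearly. -/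
def qft (n : ℕ) : Reg n →ₗ[ℂ] Reg n :=
  linExt fun i : Fin n =>
    (1 / (Real.sqrt n : ℂ)) •
      ∑ s ∈ Finset.range n, omega n ^ ((i : ℕ) * s) • ket n s

/-- `α = ⌊M/(2N) + 1/2⌋`. -/
def alpha (N M : ℕ) : ℕ := ⌊(M : ℝ) / (2 * N) + 1 / 2⌋₊

/-- The quotient `k' = round(k N / M)` in the definition of `Δ`; `round` is rounding to the nearest
integer, ties upwards. -/
def deltaQuot (N M : ℕ) (k : ℤ) : ℤ := round ((k : ℝ) * N / M)

/-- The first component `s = k' mod N` of `Δ(k)`, in `{0, …, N-1}`. -/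
def deltaS (N M : ℕ) (k : ℤ) : ℤ := deltaQuot N M k % (N : ℤ)

/-- The second component `t = k - round(k' M / N)` of `Δ(k)`, in `{-α, …, α}`. -/
def deltaT (N M : ℕ) (k : ℤ) : ℤ := k - round ((deltaQuot N M k : ℝ) * M / N)

/-- The pair `(s, t) = Δ(k)` lies in `{0, …, N-1} × {-α, …, α}`, so the labels `s` and `t + α` of
`Δ|k⟩ = |s⟩|t+α⟩` are basis labels of registers of dimension `N` and `2α + 1`. -/
theorem delta_range (N M : ℕ) (hN : 0 < N) (hM : 0 < M) (k : ℤ) :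
    (0 ≤ deltaS N M k ∧ deltaS N M k < N) ∧
      (0 ≤ deltaT N M k + alpha N M ∧ deltaT N M k + alpha N M < ((2 * alpha N M + 1 : ℕ) : ℤ)) := by
  have hN' : (0 : ℝ) < N := by exact_mod_cast hN
  have hM' : (0 : ℝ) < M := by exact_mod_cast hM
  refine ⟨⟨Int.emod_nonneg _ (by omega), Int.emod_lt_of_pos _ (by omega)⟩, ?_⟩
  have h1 : |(k : ℝ) * N / M - deltaQuot N M k| ≤ 1 / 2 := abs_sub_round _
  have h2 : |(deltaQuot N M k : ℝ) * M / N - round ((deltaQuot N M k : ℝ) * M / N)| ≤ 1 / 2 :=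
    abs_sub_round _
  have e : (k : ℝ) - (deltaQuot N M k : ℝ) * M / N
      = ((k : ℝ) * N / M - deltaQuot N M k) * (M / N) := by
    field_simp
  have h3 : |(k : ℝ) - (deltaQuot N M k : ℝ) * M / N| ≤ (M : ℝ) / (2 * N) := by
    rw [e, abs_mul, abs_of_pos (div_pos hM' hN')]
    calc _ ≤ 1 / 2 * ((M : ℝ) / N) := by gcongr
      _ = (M : ℝ) / (2 * N) := by field_simp
  have h4 : |((deltaT N M k : ℤ) : ℝ)| ≤ (M : ℝ) / (2 * N) + 1 / 2 := by
    have : ((deltaT N M k : ℤ) : ℝ) = ((k : ℝ) - (deltaQuot N M k : ℝ) * M / N)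
        + ((deltaQuot N M k : ℝ) * M / N - round ((deltaQuot N M k : ℝ) * M / N)) := by
      simp [deltaT]
    rw [this]
    exact (abs_add_le _ _).trans (add_le_add h3 h2)
  have h5 : (deltaT N M k).natAbs ≤ alpha N M := by
    refine Nat.le_floor ?_
    rw [Nat.cast_natAbs, Int.cast_abs]
    exact h4
  omega

/-- In the multiplication step, `i + j N` is a basis label of a register of dimension `M ≥ L N`. -/
theorem mul_range (N L M : ℕ) (hM : L * N ≤ M) (i : Fin N) (j : Fin L) :
    (i : ℕ) + (j : ℕ) * N < M := by
  have h : ((j : ℕ) + 1) * N ≤ L * N := Nat.mul_le_mul_right _ j.isLt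
  have := i.isLt
  nlinarith

/-- The division map on states: `Δ|k⟩ = |s⟩|t + α⟩`, extended linearly. -/
def Delta (N M : ℕ) : Reg M →ₗ[ℂ] Reg N ⊗[ℂ] Reg (2 * alpha N M + 1) :=
  linExt fun k : Fin M =>
    ket N (deltaS N M k) ⊗ₜ[ℂ] ket (2 * alpha N M + 1) (deltaT N M k + alpha N M)

/-- The multiplication step: `|i⟩|j⟩ ↦ |i + j N⟩`, extended linearly. -/
def multiply (N L M : ℕ) : Reg N ⊗[ℂ] Reg L →ₗ[ℂ] Reg M :=
  TensorProduct.lift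
    (linExt fun i : Fin N => linExt fun j : Fin L => ket M ((i : ℤ) + (j : ℤ) * N))

/-- The output `|v⟩` of the odd cyclic quantum Fourier transform algorithm on input `|u⟩`:
start from `|u⟩|0⟩`, apply `F_L` to the second register, multiply, apply `F_M`, and apply `Δ`. -/
def output (N L M : ℕ) (u : Reg N) : Reg N ⊗[ℂ] Reg (2 * alpha N M + 1) :=
  Delta N M (qft M (multiply N L M ((qft L).lTensor (Reg N) (u ⊗ₜ[ℂ] ket L 0))))

/-- The coefficient `A^i_k = (1/√(LMN)) ∑_{a=0}^{LN-1} ω_N^{-a i} ω_M^{a k}` of `|k⟩` in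
`|A^i⟩ = F_M F_{LN}^{-1} |L i⟩`. As a function of the integer `k` it is `M`-periodic, so that
indices are read modulo `M`. -/
def coeffA (N L M : ℕ) (i k : ℤ) : ℂ :=
  (1 / (Real.sqrt (L * M * N) : ℂ)) *
    ∑ a ∈ Finset.range (L * N), omega N ^ (-((a : ℤ) * i)) * omega M ^ ((a : ℤ) * k)

/-- `Λ`, the set of integers in `[-⌊M/(2N) - 1/2⌋, ⌊M/(2N) - 1/2⌋]`. -/
def Lam (N M : ℕ) : Finset ℤ :=
  Finset.Icc (-⌊(M : ℝ) / (2 * N) - 1 / 2⌋) ⌊(M : ℝ) / (2 * N) - 1 / 2⌋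

/-- The second tensor factor `∑_{t ∈ Λ} A^0_t |t + α⟩` of the approximation. -/
def bump (N L M : ℕ) : Reg (2 * alpha N M + 1) :=
  ∑ t ∈ Lam N M, coeffA N L M 0 t • ket (2 * alpha N M + 1) (t + alpha N M)

end OddQFT

end

/-!
Write `û = F_N u`. The repetition `|i⟩ ↦ ∑_j |i + jN⟩` is undone by Fourier inversion, so the state
before the division step is `∑_i û_i |A^i⟩` (`qft_multiply_apply`), where `|A^i⟩` has the
coordinates `A^i_k`, geometric sums of length `L N` concentrated near `k = i M / N` modulo `M`.

The map `Δ` sends distinct basis states to distinct basis states, hence is an isometry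
(`norm_Delta`), and since `N` is odd every pair `(s, t)` with `t ∈ Λ` is attained
(`delta_surjective`). The approximation `F_N u ⊗ ∑_t A^0_t |t + α⟩` is therefore `Δ w₀`, where
`w₀` has the coordinates `û_s A^0_t`, `(s, t) = Δ(k)`, for `t ∈ Λ` (`Delta_eq_tmul_sum`), and it
remains to compare two vectors of `ℂ^M`. Their difference has two parts.

* Rounding: `A^0_t` stands in for `A^s_k`, which amounts to a shift by the error `δ`, `|δ| ≤ 1/2`,
  of rounding `s M / N`. For fixed `s` the difference is a trigonometric polynomial in `k` with
  coefficients of size `|e^{2π√-1 a δ / M} - 1| ≤ π a / M` up to normalization, and Parseval's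
  identity gives exactly the term `π L N / (M √3)` (`sum_norm_coeffA_sub_sq_le`).
* Tails: at `k` all the `û_i A^i_k` are left over, except `i = s` when `t ∈ Λ`. There
  `|A^i_k| ≤ (L M N)^{-1/2} / |sin (π (k / M - i / N))|`, and `k N / M - i` is at distance at least
  `7 / 16` from `N ℤ` (`le_abs_of_not_mem_bump`). So the row and column sums of the matrix of tails
  are harmonic sums, of order `√(N / (L M)) log N` and `√(M / (L N)) log N`
  (`sum_norm_coeffA_tail_row_le`, `sum_norm_coeffA_tail_col_le`), and Schur's test bounds the
  tails by a multiple of `log N / √L`, with a constant well below the one required.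
-/

namespace OddQFT

/-! ### The unit circle -/

/-- The additive character `x ↦ e^{2π√-1 x}` of `ℝ`. -/
noncomputable def expTurn (x : ℝ) : ℂ := Complex.exp (Complex.I * ((2 * Real.pi * x : ℝ) : ℂ))

theorem expTurn_add (x y : ℝ) : expTurn (x + y) = expTurn x * expTurn y := by
  rw [expTurn, expTurn, expTurn, ← Complex.exp_add]
  congr 1
  push_cast
  ring

theorem expTurn_intCast (z : ℤ) : expTurn z = 1 := by
  rw [expTurn, Complex.exp_eq_one_iff]
  exact ⟨z, by push_cast; ring⟩

theorem expTurn_add_intCast (x : ℝ) (z : ℤ) : expTurn (x + z) = expTurn x := by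
  rw [expTurn_add, expTurn_intCast, mul_one]

theorem expTurn_natCast_mul (a : ℕ) (x : ℝ) : expTurn (a * x) = expTurn x ^ a := by
  rw [expTurn, expTurn, ← Complex.exp_nat_mul]
  congr 1
  push_cast
  ring

theorem norm_expTurn (x : ℝ) : ‖expTurn x‖ = 1 := by
  rw [expTurn, mul_comm]
  exact Complex.norm_exp_ofReal_mul_I _

theorem conj_expTurn (x : ℝ) : (starRingEnd ℂ) (expTurn x) = expTurn (-x) := by
  rw [expTurn, expTurn, ← Complex.exp_conj, map_mul, Complex.conj_I, Complex.conj_ofReal]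
  congr 1
  push_cast
  ring

theorem omega_zpow (n : ℕ) (z : ℤ) : omega n ^ z = expTurn (z / n) := by
  rw [omega, expTurn, ← Complex.exp_int_mul]
  congr 1
  push_cast
  ring

theorem omega_pow (n a : ℕ) : omega n ^ a = expTurn (a / n) := by
  have h := omega_zpow n a
  rwa [zpow_natCast, Int.cast_natCast] at h

theorem norm_expTurn_sub_one (x : ℝ) : ‖expTurn x - 1‖ = 2 * |Real.sin (Real.pi * x)| := by
  rw [expTurn, Complex.norm_exp_I_mul_ofReal_sub_one, Real.norm_eq_abs, abs_mul, abs_two]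
  congr 3
  ring

theorem norm_expTurn_sub_one_le (x : ℝ) : ‖expTurn x - 1‖ ≤ 2 * Real.pi * |x| := by
  rw [expTurn]
  refine (Real.norm_exp_I_mul_ofReal_sub_one_le).trans_eq ?_
  rw [Real.norm_eq_abs, abs_mul, abs_of_pos Real.two_pi_pos]

/-- A geometric sum on the unit circle is bounded independently of its length. -/
theorem norm_sum_expTurn_le (n : ℕ) (x : ℝ) (hx : Real.sin (Real.pi * x) ≠ 0) :
    ‖∑ a ∈ Finset.range n, expTurn (a * x)‖ ≤ 1 / |Real.sin (Real.pi * x)| := by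
  have hpos : 0 < |Real.sin (Real.pi * x)| := abs_pos.mpr hx
  have hne : expTurn x ≠ 1 := by
    intro h
    have := norm_expTurn_sub_one x
    rw [h] at this
    simp at this
    exact hx this
  simp_rw [expTurn_natCast_mul]
  rw [geom_sum_eq hne, norm_div, norm_expTurn_sub_one, div_le_div_iff₀ (by positivity) hpos]
  have h2 : ‖expTurn x ^ n - 1‖ ≤ 2 := by
    refine (norm_sub_le _ _).trans ?_
    rw [norm_pow, norm_expTurn, one_pow, norm_one]
    norm_num
  nlinarith

theorem expTurn_eq_one_iff (x : ℝ) : expTurn x = 1 ↔ ∃ z : ℤ, x = z := by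
  constructor
  · intro h
    rw [expTurn, Complex.exp_eq_one_iff] at h
    obtain ⟨z, hz⟩ := h
    refine ⟨z, ?_⟩
    have h1 : Complex.I * (2 * Real.pi) * (x : ℂ) = Complex.I * (2 * Real.pi) * (z : ℂ) := by
      push_cast at hz
      linear_combination hz
    have h0 : Complex.I * (2 * Real.pi) ≠ 0 := by
      simp [Real.pi_ne_zero]
    exact_mod_cast mul_left_cancel₀ h0 h1
  · rintro ⟨z, rfl⟩
    exact expTurn_intCast z

/-- Orthogonality of the characters of `ℤ/M`. -/
theorem sum_expTurn_div (M : ℕ) (hM : 0 < M) (z : ℤ) :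
    ∑ k ∈ Finset.range M, expTurn (k * (z / M)) = if (M : ℤ) ∣ z then (M : ℂ) else 0 := by
  have hM' : (M : ℝ) ≠ 0 := by positivity
  simp_rw [expTurn_natCast_mul]
  split_ifs with h
  · obtain ⟨q, rfl⟩ := h
    have : expTurn (((M * q : ℤ) : ℝ) / M) = 1 := by
      rw [expTurn_eq_one_iff]
      exact ⟨q, by push_cast; field_simp⟩
    rw [this]
    simp
  · have hne : expTurn ((z : ℝ) / M) ≠ 1 := by
      rw [Ne, expTurn_eq_one_iff]
      rintro ⟨q, hq⟩
      apply h
      rw [div_eq_iff hM'] at hq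
      exact ⟨q, by rw [mul_comm]; exact_mod_cast hq⟩
    rw [geom_sum_eq hne, ← expTurn_natCast_mul]
    have : (M : ℝ) * ((z : ℝ) / M) = z := by field_simp
    rw [this, expTurn_intCast, sub_self, zero_div]

/-- Parseval's identity on `ℤ/M` for sequences supported in `{0, …, n-1}`, `n ≤ M`. -/
theorem sum_norm_sq_sum_expTurn (M n : ℕ) (hM : 0 < M) (hn : n ≤ M) (c : ℕ → ℂ) :
    ∑ k ∈ Finset.range M, ‖∑ a ∈ Finset.range n, c a * expTurn (k * (a / M))‖ ^ 2
      = M * ∑ a ∈ Finset.range n, ‖c a‖ ^ 2 := by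
  have key : ∑ k ∈ Finset.range M, ((∑ a ∈ Finset.range n, c a * expTurn (k * (a / M))) *
      (starRingEnd ℂ) (∑ a ∈ Finset.range n, c a * expTurn (k * (a / M))))
      = M * ∑ a ∈ Finset.range n, c a * (starRingEnd ℂ) (c a) := by
    simp_rw [map_sum, map_mul, conj_expTurn, Finset.sum_mul_sum]
    rw [Finset.sum_comm, Finset.mul_sum]
    refine Finset.sum_congr rfl fun a ha => ?_
    rw [Finset.sum_comm]
    have : ∀ b ∈ Finset.range n, (∑ k ∈ Finset.range M, c a * expTurn (k * (a / M)) *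
        ((starRingEnd ℂ) (c b) * expTurn (-(k * (b / M)))))
        = if a = b then M * (c a * (starRingEnd ℂ) (c a)) else 0 := by
      intro b hb
      have h1 : ∀ k : ℕ, c a * expTurn (k * (a / M)) *
        ((starRingEnd ℂ) (c b) * expTurn (-(k * (b / M)))) = c a * (starRingEnd ℂ) (c b) *
          expTurn (k * (((a - b : ℤ) : ℝ) / M)) := by
        intro k
        have : (k : ℝ) * (((a - b : ℤ) : ℝ) / M) = k * (a / M) + -(k * (b / M)) := by
          push_cast
          ring
        rw [this, expTurn_add]
        ring
      simp_rw [h1]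
      rw [← Finset.mul_sum, sum_expTurn_div M hM]
      rw [Finset.mem_range] at ha hb
      have h2 : (M : ℤ) ∣ (a - b : ℤ) ↔ a = b := by
        constructor
        · intro h
          have := Int.eq_zero_of_abs_lt_dvd h (by rw [abs_lt]; constructor <;> omega)
          omega
        · rintro rfl
          simp
      simp only [h2]
      split_ifs with hab
      · subst hab
        ring
      · ring
    rw [Finset.sum_congr rfl this]
    simp only [Finset.sum_ite_eq, if_pos ha]
  simp_rw [Complex.mul_conj, Complex.normSq_eq_norm_sq] at key
  exact_mod_cast key

/-! ### Sums of reciprocals and Schur's test -/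

theorem one_div_le_log_div_sub_one {p : ℝ} (hp : 1 < p) : 1 / p ≤ Real.log (p / (p - 1)) := by
  have h := Real.log_le_sub_one_of_pos (x := (p - 1) / p) (div_pos (by linarith) (by linarith))
  rw [← inv_div p (p - 1), Real.log_inv, inv_div] at h
  have : (p - 1) / p - 1 = -(1 / p) := by
    field_simp
    ring
  linarith

/-- Comparison of `∑ 1 / (n + θ)` with an integral: `1 / X` accounts for the smallest term, and the
others telescope. The upper end `Y` is quantified after `S` because the induction on the largest
element lowers it. -/
theorem sum_one_div_le_log (θ X : ℝ) (hX : 0 < X) (S : Finset ℤ) :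
    ∀ Y : ℝ, X ≤ Y → (∀ n ∈ S, X ≤ n + θ ∧ n + θ ≤ Y) →
      ∑ n ∈ S, 1 / ((n : ℝ) + θ) ≤ 1 / X + Real.log (Y / X) := by
  induction S using Finset.induction_on_max with
  | empty =>
    intro Y hY _
    have : 0 ≤ Real.log (Y / X) := Real.log_nonneg ((one_le_div hX).mpr hY)
    simp only [Finset.sum_empty]
    positivity
  | insert a s hs ih =>
    intro Y hY h
    obtain ⟨ha1, ha2⟩ := h a (Finset.mem_insert_self _ _)
    rw [Finset.sum_insert (fun h => (hs a h).false)]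
    have hlt : ∀ n ∈ s, (n : ℝ) + θ ≤ a + θ - 1 := by
      intro n hn
      have : (n : ℝ) + 1 ≤ a := by exact_mod_cast hs n hn
      linarith
    have hY' : Real.log ((a + θ) / X) ≤ Real.log (Y / X) :=
      Real.log_le_log (div_pos (by linarith) hX) (by gcongr)
    rcases le_or_gt X (a + θ - 1) with hc | hc
    · have h1 := ih (a + θ - 1) hc
        (fun n hn => ⟨(h n (Finset.mem_insert_of_mem hn)).1, hlt n hn⟩)
      have h2 := one_div_le_log_div_sub_one (p := a + θ) (by linarith)
      have h3 : Real.log ((a + θ) / (a + θ - 1)) + Real.log ((a + θ - 1) / X)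
          = Real.log ((a + θ) / X) := by
        rw [Real.log_div (by linarith) (by linarith), Real.log_div (by linarith) hX.ne',
          Real.log_div (by linarith) hX.ne']
        ring
      linarith
    · have hse : s = ∅ := by
        refine Finset.eq_empty_of_forall_notMem fun n hn => ?_
        have := (h n (Finset.mem_insert_of_mem hn)).1
        linarith [hlt n hn]
      have : 0 ≤ Real.log (Y / X) := Real.log_nonneg ((one_le_div hX).mpr hY)
      have h4 : 1 / ((a : ℝ) + θ) ≤ 1 / X := one_div_le_one_div_of_le hX ha1
      rw [hse, Finset.sum_empty]
      linarith

theorem sum_one_div_abs_le_log (θ X Y : ℝ) (hX : 0 < X) (hY : X ≤ Y) (S : Finset ℤ)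
    (h : ∀ n ∈ S, X ≤ |n + θ| ∧ |n + θ| ≤ Y) :
    ∑ n ∈ S, 1 / |(n : ℝ) + θ| ≤ 2 * (1 / X + Real.log (Y / X)) := by
  rw [← Finset.sum_filter_add_sum_filter_not S (fun n : ℤ => 0 ≤ (n : ℝ) + θ)]
  have h1 : ∑ n ∈ S.filter (fun n : ℤ => 0 ≤ (n : ℝ) + θ), 1 / |(n : ℝ) + θ|
      ≤ 1 / X + Real.log (Y / X) := by
    rw [Finset.sum_congr rfl (g := fun n : ℤ => 1 / ((n : ℝ) + θ))]
    · refine sum_one_div_le_log θ X hX _ Y hY fun n hn => ?_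
      rw [Finset.mem_filter] at hn
      have := h n hn.1
      rwa [abs_of_nonneg hn.2] at this
    · intro n hn
      rw [abs_of_nonneg (Finset.mem_filter.mp hn).2]
  have h2 : ∑ n ∈ S.filter (fun n : ℤ => ¬ 0 ≤ (n : ℝ) + θ), 1 / |(n : ℝ) + θ|
      ≤ 1 / X + Real.log (Y / X) := by
    have := sum_one_div_le_log (-θ) X hX
      ((S.filter (fun n : ℤ => ¬ 0 ≤ (n : ℝ) + θ)).map (Equiv.neg ℤ).toEmbedding) Y hY ?_
    · rw [Finset.sum_map] at this
      refine le_trans (le_of_eq (Finset.sum_congr rfl fun n hn => ?_)) this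
      rw [abs_of_neg (not_le.mp (Finset.mem_filter.mp hn).2)]
      simp only [Equiv.coe_toEmbedding, Equiv.neg_apply]
      push_cast
      congr 1
      ring
    · intro n hn
      simp only [Finset.mem_map, Equiv.coe_toEmbedding, Equiv.neg_apply, Finset.mem_filter] at hn
      obtain ⟨k, ⟨hk, hk0⟩, rfl⟩ := hn
      have := h k hk
      rw [abs_of_neg (not_le.mp hk0)] at this
      push_cast
      constructor <;> linarith [this.1, this.2]
  linarith

/-- If the integers `f i` are distinct modulo `m` and the points `f i + θ` stay at distance at
at least `X` from `mℤ`, then the sum of `1 / |sin (π (f i + θ) / m)|` is controlled by a harmonic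
sum, through `|sin (π x)| ≥ 2 |x|` for `|x| ≤ 1 / 2`. -/
theorem sum_one_div_abs_sin_le {ι : Type*} (S : Finset ι) (f : ι → ℤ) (m : ℕ) (hm : 0 < m)
    (θ X : ℝ) (hX : 0 < X) (hXm : X ≤ m / 2)
    (hinj : ∀ i ∈ S, ∀ j ∈ S, (m : ℤ) ∣ f i - f j → i = j)
    (hdist : ∀ i ∈ S, ∀ r : ℤ, X ≤ |f i + θ - m * r|) :
    ∑ i ∈ S, 1 / |Real.sin (Real.pi * ((f i + θ) / m))|
      ≤ m * (1 / X + Real.log (m / (2 * X))) := by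
  have hm' : (0 : ℝ) < m := by exact_mod_cast hm
  -- the representative of `f i` for which `f i + θ` lies in `[-m/2, m/2]`
  let g : ι → ℤ := fun i => f i - m * round ((f i + θ) / m)
  have hg : ∀ i, (g i : ℝ) + θ = f i + θ - m * round ((f i + θ) / m) := by
    intro i
    simp only [g]
    push_cast
    ring
  have hgm : ∀ i, |(g i : ℝ) + θ| ≤ m / 2 := by
    intro i
    have h := abs_sub_round ((f i + θ) / (m : ℝ))
    have e : (g i : ℝ) + θ = ((f i + θ) / (m : ℝ) - round ((f i + θ) / (m : ℝ))) * m := by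
      rw [hg]
      field_simp
    rw [e, abs_mul, abs_of_pos hm']
    calc _ ≤ 1 / 2 * (m : ℝ) := by gcongr
      _ = m / 2 := by ring
  have hginj : Set.InjOn g S := by
    intro i hi j hj hij
    refine hinj i hi j hj ⟨round ((f i + θ) / m) - round ((f j + θ) / m), ?_⟩
    simp only [g] at hij
    linarith
  have hterm : ∀ i ∈ S, 1 / |Real.sin (Real.pi * ((f i + θ) / m))|
      ≤ m / 2 * (1 / |(g i : ℝ) + θ|) := by
    intro i hi
    have hpos : 0 < |(g i : ℝ) + θ| := by
      rw [hg]
      exact lt_of_lt_of_le hX (hdist i hi _)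
    have e : Real.pi * ((f i + θ) / m)
        = Real.pi * ((g i + θ) / m) + round ((f i + θ) / m) * Real.pi := by
      rw [hg]
      field_simp
      ring
    have e2 : |Real.sin (Real.pi * ((f i + θ) / m))| = |Real.sin (Real.pi * ((g i + θ) / m))| := by
      rw [e, Real.sin_add_int_mul_pi, abs_mul]
      simp
    have hle : |Real.pi * (((g i : ℝ) + θ) / m)| ≤ Real.pi / 2 := by
      rw [abs_mul, abs_of_pos Real.pi_pos, abs_div, abs_of_pos hm']
      have : |(g i : ℝ) + θ| / m ≤ 1 / 2 := by
        rw [div_le_iff₀ hm']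
        linarith [hgm i]
      nlinarith [Real.pi_pos]
    have hsin := Real.mul_abs_le_abs_sin hle
    have e3 : 2 / Real.pi * |Real.pi * (((g i : ℝ) + θ) / m)| = 2 * |(g i : ℝ) + θ| / m := by
      rw [abs_mul, abs_of_pos Real.pi_pos, abs_div, abs_of_pos hm']
      field_simp
    rw [e3] at hsin
    rw [e2]
    refine (one_div_le_one_div_of_le (by positivity) hsin).trans_eq ?_
    field_simp
  refine (Finset.sum_le_sum hterm).trans ?_
  rw [← Finset.mul_sum, ← Finset.sum_image (f := fun n : ℤ => 1 / |(n : ℝ) + θ|) hginj]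
  have := sum_one_div_abs_le_log θ X (m / 2) hX hXm (S.image g) ?_
  · calc _ ≤ (m : ℝ) / 2 * (2 * (1 / X + Real.log (m / 2 / X))) := by gcongr
      _ = _ := by
        rw [div_div]
        ring
  · intro n hn
    obtain ⟨i, hi, rfl⟩ := Finset.mem_image.mp hn
    exact ⟨by rw [hg]; exact hdist i hi _, hgm i⟩

/-- Schur's test: a matrix whose rows and columns have `ℓ¹` norms at most `R` and `C` has
squared `ℓ²` operator norm at most `R * C`. -/
theorem schur_test {ι κ : Type*} (s : Finset ι) (t : Finset κ) (B : κ → ι → ℂ) (x : ι → ℂ)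
    (R C : ℝ) (hR0 : 0 ≤ R) (hR : ∀ k ∈ t, ∑ i ∈ s, ‖B k i‖ ≤ R)
    (hC : ∀ i ∈ s, ∑ k ∈ t, ‖B k i‖ ≤ C) :
    ∑ k ∈ t, ‖∑ i ∈ s, x i * B k i‖ ^ 2 ≤ R * C * ∑ i ∈ s, ‖x i‖ ^ 2 := by
  calc ∑ k ∈ t, ‖∑ i ∈ s, x i * B k i‖ ^ 2
      ≤ ∑ k ∈ t, R * ∑ i ∈ s, ‖B k i‖ * ‖x i‖ ^ 2 := by
        refine Finset.sum_le_sum fun k hk => ?_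
        have h1 : ‖∑ i ∈ s, x i * B k i‖ ≤ ∑ i ∈ s, ‖x i‖ * ‖B k i‖ :=
          (norm_sum_le _ _).trans_eq (Finset.sum_congr rfl fun i _ => norm_mul _ _)
        have h2 : (∑ i ∈ s, ‖x i‖ * ‖B k i‖) ^ 2
            ≤ (∑ i ∈ s, ‖B k i‖) * ∑ i ∈ s, ‖B k i‖ * ‖x i‖ ^ 2 :=
          Finset.sum_sq_le_sum_mul_sum_of_sq_le_mul s (fun i _ => by positivity)
            (fun i _ => by positivity) (fun i _ => le_of_eq (by ring))
        calc _ ≤ (∑ i ∈ s, ‖x i‖ * ‖B k i‖) ^ 2 := by gcongr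
          _ ≤ _ := h2
          _ ≤ _ := by
            gcongr
            exact hR k hk
    _ = R * ∑ i ∈ s, ‖x i‖ ^ 2 * ∑ k ∈ t, ‖B k i‖ := by
        rw [← Finset.mul_sum, Finset.sum_comm]
        simp_rw [Finset.mul_sum]
        simp_rw [mul_comm]
    _ ≤ R * ∑ i ∈ s, ‖x i‖ ^ 2 * C := by
        gcongr with i hi
        exact hC i hi
    _ = _ := by
        rw [← Finset.sum_mul]
        ring

/-! ### Coordinates of the maps in the algorithm -/

theorem linExt_apply {n : ℕ} {E : Type*} [AddCommGroup E] [Module ℂ E] (f : Fin n → E)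
    (v : Reg n) : linExt f v = ∑ i, v i • f i := by
  rw [linExt, Module.Basis.constr_apply_fintype]
  rfl

theorem ket_apply (n : ℕ) (a : ℤ) (j : Fin n) : ket n a j = if (j : ℤ) = a then 1 else 0 := rfl

theorem ket_natCast (n : ℕ) (i : Fin n) : ket n (i : ℕ) = EuclideanSpace.single i (1 : ℂ) := by
  ext j
  rw [ket_apply, PiLp.single_apply]
  congr 1
  rw [Fin.ext_iff, Nat.cast_inj]

theorem linExt_ket {n : ℕ} {E : Type*} [AddCommGroup E] [Module ℂ E] (f : Fin n → E)
    (i : Fin n) : linExt f (ket n (i : ℕ)) = f i := by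
  rw [linExt_apply, ket_natCast]
  simp

theorem sum_smul_ket (n : ℕ) (v : Reg n) : v = ∑ i : Fin n, v i • ket n (i : ℕ) := by
  ext j
  simp_rw [ket_natCast]
  simp [Pi.single_apply]

theorem inner_ket_ket (n : ℕ) (a b : ℤ) (ha0 : 0 ≤ a) (han : a < n) :
    inner ℂ (ket n a) (ket n b) = if a = b then (1 : ℂ) else 0 := by
  lift a to ℕ using ha0
  have h := ket_natCast n ⟨a, by exact_mod_cast han⟩
  rw [show ((⟨a, by exact_mod_cast han⟩ : Fin n) : ℕ) = a from rfl] at h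
  rw [h, EuclideanSpace.inner_single_left, ket_apply]
  simp

theorem qft_apply (n : ℕ) (v : Reg n) (k : Fin n) :
    qft n v k = (1 / (Real.sqrt n : ℂ)) * ∑ i : Fin n, v i * expTurn ((i : ℕ) * ((k : ℕ) / n)) := by
  rw [qft, linExt_apply, WithLp.ofLp_sum, Finset.sum_apply, Finset.mul_sum]
  refine Finset.sum_congr rfl fun i _ => ?_
  rw [PiLp.smul_apply, PiLp.smul_apply, WithLp.ofLp_sum, Finset.sum_apply]
  simp_rw [PiLp.smul_apply, ket_apply, Nat.cast_inj, smul_eq_mul, mul_ite, mul_one, mul_zero]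
  rw [Finset.sum_ite_eq, if_pos (Finset.mem_range.mpr k.isLt), omega_pow]
  push_cast
  rw [mul_div_assoc]
  ring

/-- The first Fourier transform prepares the uniform superposition. -/
theorem qft_ket_zero (L : ℕ) (hL : 0 < L) :
    qft L (ket L 0) = ∑ j : Fin L, (1 / (Real.sqrt L : ℂ)) • ket L (j : ℕ) := by
  have h0 : ket L 0 = ket L ((⟨0, hL⟩ : Fin L) : ℕ) := rfl
  rw [h0, qft, linExt_ket, Finset.smul_sum, Finset.sum_range]
  simp

theorem multiply_apply (N L M : ℕ) (hL : 0 < L) (u : Reg N) :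
    multiply N L M ((qft L).lTensor (Reg N) (u ⊗ₜ[ℂ] ket L 0))
      = ∑ i : Fin N, ∑ j : Fin L,
        (u i * (1 / (Real.sqrt L : ℂ))) • ket M (((i : ℕ) + (j : ℕ) * N : ℕ) : ℤ) := by
  rw [LinearMap.lTensor_tmul, multiply, TensorProduct.lift.tmul, linExt_apply,
    LinearMap.sum_apply]
  refine Finset.sum_congr rfl fun i _ => ?_
  rw [LinearMap.smul_apply, qft_ket_zero L hL, map_sum, Finset.smul_sum]
  refine Finset.sum_congr rfl fun j _ => ?_
  rw [map_smul, linExt_ket, smul_smul]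
  push_cast
  rfl

theorem qft_ket_apply (M : ℕ) (a : ℕ) (ha : a < M) (k : Fin M) :
    qft M (ket M (a : ℕ)) k = (1 / (Real.sqrt M : ℂ)) * expTurn (a * ((k : ℕ) / M)) := by
  rw [qft_apply, Finset.sum_eq_single (⟨a, ha⟩ : Fin M)]
  · simp [ket_apply]
  · intro b _ hb
    have : ¬ (b : ℕ) = a := fun h => hb (Fin.ext h)
    simp [ket_apply, this]
  · simp

/-- Coordinates of `F_N^{-1} F_N u`, extended `N`-periodically. -/
theorem sum_qft_apply_mul (N : ℕ) (hN : 0 < N) (u : Reg N) (i : Fin N) (j : ℕ) :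
    ∑ s : Fin N, qft N u s * expTurn (-(((i : ℕ) + j * N : ℕ) * ((s : ℕ) / N)))
      = Real.sqrt N * u i := by
  have hN' : (N : ℝ) ≠ 0 := by positivity
  have hs : (Real.sqrt N : ℂ) ≠ 0 := by
    exact_mod_cast (Real.sqrt_pos.mpr (by positivity : (0 : ℝ) < N)).ne'
  have hsq : (Real.sqrt N : ℂ) * Real.sqrt N = N := by
    exact_mod_cast Real.mul_self_sqrt (Nat.cast_nonneg N)
  have h1 : ∀ s l : Fin N, expTurn ((l : ℕ) * ((s : ℕ) / N)) *
      expTurn (-(((i : ℕ) + j * N : ℕ) * ((s : ℕ) / N)))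
      = expTurn ((s : ℕ) * ((((l : ℕ) - (i : ℕ) : ℤ) : ℝ) / N)) := by
    intro s l
    rw [← expTurn_add, ← expTurn_add_intCast (((s : ℕ) : ℝ) * _) (-(j * (s : ℕ)))]
    congr 1
    push_cast
    field_simp
    ring
  simp_rw [qft_apply, mul_assoc, Finset.sum_mul, mul_assoc, h1]
  rw [← Finset.mul_sum, Finset.sum_comm]
  simp_rw [← Finset.mul_sum]
  have h2 : ∀ l : Fin N, ∑ s : Fin N, expTurn ((s : ℕ) * ((((l : ℕ) - (i : ℕ) : ℤ) : ℝ) / N))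
      = if l = i then (N : ℂ) else 0 := by
    intro l
    rw [← Finset.sum_range fun s => expTurn (s * ((((l : ℕ) - (i : ℕ) : ℤ) : ℝ) / N)),
      sum_expTurn_div N hN]
    have : (N : ℤ) ∣ ((l : ℕ) - (i : ℕ) : ℤ) ↔ l = i := by
      constructor
      · intro h
        have := Int.eq_zero_of_abs_lt_dvd h (by rw [abs_lt]; constructor <;> omega)
        exact Fin.ext (by omega)
      · rintro rfl
        simp
    simp only [this]
  simp_rw [h2]
  simp only [mul_ite, mul_zero, Finset.sum_ite_eq', Finset.mem_univ, if_true]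
  rw [← hsq]
  field_simp

theorem coeffA_eq (N L M : ℕ) (i k : ℤ) :
    coeffA N L M i k = (1 / (Real.sqrt (L * M * N) : ℂ)) *
      ∑ a ∈ Finset.range (L * N), expTurn (a * (k / M - i / N)) := by
  rw [coeffA]
  congr 1
  refine Finset.sum_congr rfl fun a _ => ?_
  rw [omega_zpow, omega_zpow, ← expTurn_add]
  congr 1
  push_cast
  ring

theorem coeffA_add_mul (N L M : ℕ) (hM : 0 < M) (i k q : ℤ) :
    coeffA N L M i (k + M * q) = coeffA N L M i k := by
  have : (M : ℝ) ≠ 0 := by positivity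
  rw [coeffA_eq, coeffA_eq]
  congr 1
  refine Finset.sum_congr rfl fun a _ => ?_
  rw [← expTurn_add_intCast (a * (k / M - i / N)) (a * q)]
  congr 1
  push_cast
  field_simp
  ring

/-- Since `F_M (∑ u_i |i + jN⟩) / √L = ∑ û_i |A^i⟩` with `û = F_N u`, the state before the
division step has the coordinates `∑ û_i A^i_k`. -/
theorem qft_multiply_apply (N L M : ℕ) (hN : 0 < N) (hL : 0 < L) (hLM : L * N ≤ M) (u : Reg N)
    (k : Fin M) :
    qft M (multiply N L M ((qft L).lTensor (Reg N) (u ⊗ₜ[ℂ] ket L 0))) k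
      = ∑ i : Fin N, qft N u i * coeffA N L M (i : ℕ) (k : ℕ) := by
  have hs : (Real.sqrt N : ℂ) ≠ 0 := by
    exact_mod_cast (Real.sqrt_pos.mpr (by positivity : (0 : ℝ) < N)).ne'
  rw [multiply_apply N L M hL]
  have hr : ∀ f : ℕ → ℂ, ∑ a ∈ Finset.range (L * N), f a
      = ∑ i : Fin N, ∑ j : Fin L, f ((i : ℕ) + (j : ℕ) * N) := by
    intro f
    rw [Finset.sum_range, ← finProdFinEquiv.sum_comp, Fintype.sum_prod_type, Finset.sum_comm]
    simp [finProdFinEquiv, mul_comm]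
  simp_rw [map_sum, map_smul, WithLp.ofLp_sum, Finset.sum_apply, PiLp.smul_apply]
  simp_rw [coeffA_eq]
  have h1 : ∀ s : Fin N, qft N u s * ((1 / (Real.sqrt (L * M * N) : ℂ)) *
      ∑ a ∈ Finset.range (L * N), expTurn (a * (((k : ℕ) : ℤ) / M - ((s : ℕ) : ℤ) / N)))
      = ∑ i : Fin N, ∑ j : Fin L, (1 / (Real.sqrt (L * M * N) : ℂ)) *
        expTurn (((i : ℕ) + (j : ℕ) * N : ℕ) * ((k : ℕ) / M)) *
        (qft N u s * expTurn (-(((i : ℕ) + (j : ℕ) * N : ℕ) * ((s : ℕ) / N)))) := by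
    intro s
    rw [hr]
    simp_rw [Finset.mul_sum]
    refine Finset.sum_congr rfl fun i _ => Finset.sum_congr rfl fun j _ => ?_
    rw [mul_sub, sub_eq_add_neg, expTurn_add]
    push_cast
    ring
  simp_rw [h1]
  refine Eq.trans ?_ Finset.sum_comm
  refine Finset.sum_congr rfl fun i _ => ?_
  refine Eq.trans ?_ Finset.sum_comm
  refine Finset.sum_congr rfl fun j _ => ?_
  rw [← Finset.mul_sum, sum_qft_apply_mul N hN, qft_ket_apply M _ (mul_range N L M hLM i j),
    Real.sqrt_mul (by positivity), Real.sqrt_mul (by positivity), smul_eq_mul]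
  push_cast
  field_simp

/-- The Fourier transform is norm preserving. -/
theorem sum_norm_qft_sq (N : ℕ) (hN : 0 < N) (u : Reg N) :
    ∑ s : Fin N, ‖qft N u s‖ ^ 2 = ‖u‖ ^ 2 := by
  have hN' : (0 : ℝ) < N := by positivity
  have h := sum_norm_sq_sum_expTurn N N hN le_rfl
    (fun a => if h : a < N then u ⟨a, h⟩ else 0)
  simp_rw [Finset.sum_range] at h
  simp only [Fin.is_lt, dif_pos, Fin.eta] at h
  rw [EuclideanSpace.norm_sq_eq]
  have h2 : ∀ s : Fin N, ‖qft N u s‖ ^ 2 = 1 / N *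
      ‖∑ a : Fin N, u a * expTurn ((s : ℕ) * ((a : ℕ) / N))‖ ^ 2 := by
    intro s
    rw [qft_apply, norm_mul, mul_pow, norm_div, norm_one, Complex.norm_real,
      Real.norm_of_nonneg (Real.sqrt_nonneg _), div_pow, Real.sq_sqrt hN'.le, one_pow]
    congr 3
    refine Finset.sum_congr rfl fun a _ => ?_
    congr 2
    ring
  simp_rw [h2]
  rw [← Finset.mul_sum, h]
  field_simp

/-! ### The division step -/

theorem deltaQuot_add_mul (N M : ℕ) (hM : 0 < M) (k q : ℤ) :
    deltaQuot N M (k + M * q) = deltaQuot N M k + N * q := by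
  have hM' : (M : ℝ) ≠ 0 := by positivity
  rw [deltaQuot, deltaQuot, ← round_add_intCast]
  congr 1
  push_cast
  field_simp

theorem round_add_mul_div (N M : ℕ) (hN : 0 < N) (s r : ℤ) :
    round (((s + N * r : ℤ) : ℝ) * M / N) = round ((s : ℝ) * M / N) + M * r := by
  have hN' : (N : ℝ) ≠ 0 := by positivity
  rw [← round_add_intCast]
  congr 1
  push_cast
  field_simp

theorem deltaS_add_mul (N M : ℕ) (hM : 0 < M) (k q : ℤ) :
    deltaS N M (k + M * q) = deltaS N M k := by
  rw [deltaS, deltaS, deltaQuot_add_mul N M hM, Int.add_mul_emod_self_left]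

theorem deltaT_add_mul (N M : ℕ) (hN : 0 < N) (hM : 0 < M) (k q : ℤ) :
    deltaT N M (k + M * q) = deltaT N M k := by
  rw [deltaT, deltaT, deltaQuot_add_mul N M hM, round_add_mul_div N M hN]
  ring

/-- Modulo `M`, the label `k` is recovered from `(s, t) = Δ(k)` as `round (s M / N) + t`. -/
theorem exists_eq_round_add_deltaT (N M : ℕ) (hN : 0 < N) (k : ℤ) :
    ∃ r : ℤ, k = round ((deltaS N M k : ℝ) * M / N) + deltaT N M k + M * r := by
  refine ⟨deltaQuot N M k / N, ?_⟩
  have h : deltaQuot N M k = deltaS N M k + N * (deltaQuot N M k / N) :=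
    (Int.emod_add_mul_ediv _ _).symm
  have h2 := round_add_mul_div N M hN (deltaS N M k) (deltaQuot N M k / N)
  rw [← h] at h2
  rw [deltaT, h2]
  ring

theorem delta_injective (N M : ℕ) (hN : 0 < N) (k l : Fin M)
    (hs : deltaS N M (k : ℕ) = deltaS N M (l : ℕ)) (ht : deltaT N M (k : ℕ) = deltaT N M (l : ℕ)) :
    k = l := by
  obtain ⟨r, hr⟩ := exists_eq_round_add_deltaT N M hN (k : ℕ)
  obtain ⟨q, hq⟩ := exists_eq_round_add_deltaT N M hN (l : ℕ)
  rw [hs, ht] at hr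
  -- both labels lie in `{0, …, M - 1}`, so congruence modulo `M` is equality
  have hd : (M : ℤ) ∣ ((k : ℕ) - (l : ℕ) : ℤ) := ⟨r - q, by linear_combination hr - hq⟩
  have := Int.eq_zero_of_abs_lt_dvd hd (by rw [abs_lt]; constructor <;> omega)
  exact Fin.ext (by omega)

theorem Delta_apply (N M : ℕ) (w : Reg M) :
    Delta N M w = ∑ k : Fin M, w k • (ket N (deltaS N M (k : ℕ)) ⊗ₜ[ℂ]
      ket (2 * alpha N M + 1) (deltaT N M (k : ℕ) + alpha N M)) := by
  rw [Delta, linExt_apply]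

/-- The images `|s⟩|t + α⟩` of the basis states under `Δ` are distinct basis states. -/
theorem orthonormal_delta (N M : ℕ) (hN : 0 < N) (hM : 0 < M) :
    Orthonormal ℂ fun k : Fin M => ket N (deltaS N M (k : ℕ)) ⊗ₜ[ℂ]
      ket (2 * alpha N M + 1) (deltaT N M (k : ℕ) + alpha N M) := by
  classical
  rw [orthonormal_iff_ite]
  intro k l
  obtain ⟨⟨h1, h2⟩, h3, h4⟩ := delta_range N M hN hM (k : ℕ)
  rw [TensorProduct.inner_tmul, inner_ket_ket _ _ _ h1 h2, inner_ket_ket _ _ _ h3 h4]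
  by_cases hkl : k = l
  · simp [hkl]
  · rw [if_neg hkl]
    by_cases hs : deltaS N M (k : ℕ) = deltaS N M (l : ℕ)
    · have ht : deltaT N M (k : ℕ) ≠ deltaT N M (l : ℕ) :=
        fun ht => hkl (delta_injective N M hN k l hs ht)
      simp [ht]
    · simp [hs]

theorem norm_Delta (N M : ℕ) (hN : 0 < N) (hM : 0 < M) (w : Reg M) : ‖Delta N M w‖ = ‖w‖ := by
  have h := (orthonormal_delta N M hN hM).inner_sum w w Finset.univ
  rw [← Delta_apply, inner_self_eq_norm_sq_to_K] at h
  have h2 : ‖Delta N M w‖ ^ 2 = ‖w‖ ^ 2 := by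
    rw [EuclideanSpace.norm_sq_eq]
    simp_rw [Complex.conj_mul'] at h
    apply Complex.ofReal_injective
    push_cast
    exact h
  exact (sq_eq_sq₀ (norm_nonneg _) (norm_nonneg _)).mp h2

theorem mem_Lam (N M : ℕ) (t : ℤ) : t ∈ Lam N M ↔ |(t : ℝ)| ≤ (M : ℝ) / (2 * N) - 1 / 2 := by
  rw [Lam, Finset.mem_Icc, ← abs_le, Int.le_floor, Int.cast_abs]

/-- For odd `N` no multiple of `1 / N` is a half-integer, so the rounding error of `s M / N` is
strictly less than `1 / 2`. -/
theorem abs_sub_round_lt_half (N M : ℕ) (hN : Odd N) (s : ℤ) :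
    |(s : ℝ) * M / N - round ((s : ℝ) * M / N)| < 1 / 2 := by
  have hN' : (N : ℝ) ≠ 0 := by exact_mod_cast hN.pos.ne'
  refine lt_of_le_of_ne (abs_sub_round _) fun h => ?_
  set r := round ((s : ℝ) * M / N)
  obtain ⟨n, hn⟩ := hN
  have hz : ∀ e : ℝ, (s : ℝ) * M / N - r = e / 2 → 2 * ((s : ℝ) * M) - 2 * (r * N) = e * N := by
    intro e he
    field_simp at he
    linarith
  rcases eq_or_eq_neg_of_abs_eq h with h | h
  · have h1 := hz 1 h
    have h2 : 2 * (s * M) - 2 * (r * N) = 1 * (N : ℤ) := by exact_mod_cast h1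
    omega
  · have h1 := hz (-1) (by linarith)
    have h2 : 2 * (s * M) - 2 * (r * N) = -1 * (N : ℤ) := by exact_mod_cast h1
    omega

/-- Every pair `(s, t)` with `t ∈ Λ` is attained by `Δ`. -/
theorem delta_surjective (N M : ℕ) (hN : Odd N) (hM : 0 < M) (s : Fin N) (t : ℤ)
    (ht : t ∈ Lam N M) :
    ∃ k : Fin M, deltaS N M (k : ℕ) = (s : ℕ) ∧ deltaT N M (k : ℕ) = t := by
  have hN' : (0 : ℝ) < N := by exact_mod_cast hN.pos
  have hM' : (0 : ℝ) < M := by exact_mod_cast hM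
  set r := round ((((s : ℕ) : ℤ) : ℝ) * M / N) with hr
  have hQ : deltaQuot N M (r + t) = (s : ℕ) := by
    rw [mem_Lam] at ht
    have h1 := abs_sub_round_lt_half N M hN (s : ℕ)
    rw [← hr] at h1
    have h2 : |((r + t : ℤ) : ℝ) - (((s : ℕ) : ℤ) : ℝ) * M / N| < M / (2 * N) := by
      have e : ((r + t : ℤ) : ℝ) - (((s : ℕ) : ℤ) : ℝ) * M / N
          = t - ((((s : ℕ) : ℤ) : ℝ) * M / N - r) := by
        push_cast
        ring
      rw [e]
      refine (abs_sub _ _).trans_lt ?_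
      linarith
    have h3 : |((r + t : ℤ) : ℝ) * N / M - (((s : ℕ) : ℤ) : ℝ)| < 1 / 2 := by
      have e : ((r + t : ℤ) : ℝ) * N / M - (((s : ℕ) : ℤ) : ℝ)
          = (((r + t : ℤ) : ℝ) - (((s : ℕ) : ℤ) : ℝ) * M / N) * (N / M) := by
        field_simp
      rw [e, abs_mul, abs_of_pos (div_pos hN' hM')]
      calc _ < (M : ℝ) / (2 * N) * (N / M) := by gcongr
        _ = 1 / 2 := by field_simp
    rw [deltaQuot, round_eq_iff]
    rw [abs_lt] at h3
    exact ⟨by linarith, by linarith⟩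
  have hS : deltaS N M (r + t) = (s : ℕ) := by
    rw [deltaS, hQ]
    exact Int.emod_eq_of_lt (by positivity) (by exact_mod_cast s.isLt)
  have hT : deltaT N M (r + t) = t := by
    rw [deltaT, hQ, ← hr]
    ring
  -- the label `r + t` need not lie in `{0, …, M - 1}`, and is reduced modulo `M`
  have hk0 : 0 ≤ (r + t) % (M : ℤ) := Int.emod_nonneg _ (by omega)
  have hk1 : (r + t) % (M : ℤ) < M := Int.emod_lt_of_pos _ (by omega)
  have hk2 : (r + t) % (M : ℤ) = (r + t) + M * (-((r + t) / M)) := by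
    linarith [Int.emod_add_mul_ediv (r + t) (M : ℤ)]
  refine ⟨⟨((r + t) % (M : ℤ)).toNat, by omega⟩, ?_⟩
  have hc : ((((r + t) % (M : ℤ)).toNat : ℕ) : ℤ) = (r + t) + M * (-((r + t) / M)) := by
    rw [Int.toNat_of_nonneg hk0, hk2]
  simp only [hc]
  rw [deltaS_add_mul N M hM, deltaT_add_mul N M hN.pos hM]
  exact ⟨hS, hT⟩

/-- A vector of the form `x ⊗ ∑_{t ∈ Λ} A_t |t + α⟩` is the image under `Δ` of the vector with
coordinates `x_s A_t`, `(s, t) = Δ(k)`, on the labels `k` with `t ∈ Λ`. -/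
theorem Delta_eq_tmul_sum (N M : ℕ) (hN : Odd N) (hM : 0 < M) (x : Reg N) (A : ℤ → ℂ)
    (σ : Fin M → Fin N) (hσ : ∀ k, ((σ k : ℕ) : ℤ) = deltaS N M (k : ℕ)) :
    Delta N M (WithLp.toLp 2 fun k => if deltaT N M (k : ℕ) ∈ Lam N M then
        x (σ k) * A (deltaT N M (k : ℕ)) else 0)
      = x ⊗ₜ[ℂ] ∑ t ∈ Lam N M, A t • ket (2 * alpha N M + 1) (t + alpha N M) := by
  conv_rhs => rw [sum_smul_ket N x]
  rw [Delta_apply, TensorProduct.sum_tmul]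
  simp_rw [TensorProduct.tmul_sum, ite_smul, zero_smul]
  rw [← Finset.sum_product', ← Finset.sum_filter]
  refine Finset.sum_bij (fun k _ => (σ k, deltaT N M (k : ℕ))) ?_ ?_ ?_ ?_
  · intro k hk
    simpa using hk
  · intro k _ l _ h
    rw [Prod.mk.injEq] at h
    exact delta_injective N M hN.pos k l (by rw [← hσ, ← hσ, h.1]) h.2
  · rintro ⟨s, t⟩ h
    rw [Finset.mem_product] at h
    obtain ⟨k, hk1, hk2⟩ := delta_surjective N M hN hM s t h.2
    refine ⟨k, ?_, ?_⟩
    · simpa [hk2] using h.2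
    · rw [Prod.mk.injEq]
      refine ⟨Fin.ext ?_, hk2⟩
      have := hσ k
      omega
  · intro k _
    rw [TensorProduct.smul_tmul_smul, hσ]

/-! ### The rounding error -/

theorem sum_range_sq_le (n : ℕ) : ∑ a ∈ Finset.range n, (a : ℝ) ^ 2 ≤ (n : ℝ) ^ 3 / 3 := by
  induction n with
  | zero => simp
  | succ n ih =>
    rw [Finset.sum_range_succ]
    push_cast
    have : (0 : ℝ) ≤ n := Nat.cast_nonneg n
    nlinarith

/-- The difference `A^s_k - A^0_t` with `(s, t) = Δ(k)`, as a trigonometric polynomial in `k`. -/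
theorem coeffA_sub_coeffA (N L M : ℕ) (hN : 0 < N) (hM : 0 < M) (k : ℤ) :
    coeffA N L M (deltaS N M k) k - coeffA N L M 0 (deltaT N M k)
      = ∑ a ∈ Finset.range (L * N), (1 / (Real.sqrt (L * M * N) : ℂ)) *
        (expTurn (a * ((round ((deltaS N M k : ℝ) * M / N) - (deltaS N M k : ℝ) * M / N) / M)) - 1)
          * expTurn (-(a * (round ((deltaS N M k : ℝ) * M / N) / M)))
          * expTurn (k * (a / M)) := by
  have hN' : (N : ℝ) ≠ 0 := by positivity
  have hM' : (M : ℝ) ≠ 0 := by positivity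
  obtain ⟨r, hr⟩ := exists_eq_round_add_deltaT N M hN k
  set p := round ((deltaS N M k : ℝ) * M / N)
  set s := deltaS N M k
  have ht : deltaT N M k = (k - p) + M * (-r) := by linarith
  rw [ht, coeffA_add_mul N L M hM, coeffA_eq, coeffA_eq, ← mul_sub, ← Finset.sum_sub_distrib,
    Finset.mul_sum]
  refine Finset.sum_congr rfl fun a _ => ?_
  have e1 : (a : ℝ) * (k / M - s / N)
      = a * ((p - s * M / N) / M) + -(a * (p / M)) + k * (a / M) := by
    field_simp
    ring
  have e2 : (a : ℝ) * ((k - p : ℤ) / M - (0 : ℤ) / N) = -(a * (p / M)) + k * (a / M) := by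
    push_cast
    field_simp
    ring
  rw [e1, e2, expTurn_add, expTurn_add, expTurn_add]
  ring

/-- The `ℓ²` norm of the rounding error for a fixed `s`. The sum runs over all `k`, not only those
with first component `s`, so that Parseval's identity applies. -/
theorem sum_norm_coeffA_sub_sq_le (N L M : ℕ) (hN : 0 < N) (hL : 0 < L) (hLM : L * N ≤ M)
    (s : ℤ) :
    ∑ k ∈ Finset.range M, ‖∑ a ∈ Finset.range (L * N), (1 / (Real.sqrt (L * M * N) : ℂ)) *
        (expTurn (a * ((round ((s : ℝ) * M / N) - (s : ℝ) * M / N) / M)) - 1)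
          * expTurn (-(a * (round ((s : ℝ) * M / N) / M)))
          * expTurn (k * (a / M))‖ ^ 2 ≤ (Real.pi * L * N / (M * Real.sqrt 3)) ^ 2 := by
  have hM : 0 < M := lt_of_lt_of_le (Nat.mul_pos hL hN) hLM
  have hN' : (0 : ℝ) < N := by positivity
  have hL' : (0 : ℝ) < L := by positivity
  have hM' : (0 : ℝ) < M := by positivity
  rw [sum_norm_sq_sum_expTurn M (L * N) hM hLM]
  set δ := round ((s : ℝ) * M / N) - (s : ℝ) * M / N with hδ
  have hδ2 : |δ| ≤ 1 / 2 := by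
    rw [hδ, abs_sub_comm]
    exact abs_sub_round _
  have hterm : ∀ a ∈ Finset.range (L * N), ‖(1 / (Real.sqrt (L * M * N) : ℂ)) *
        (expTurn (a * (δ / M)) - 1) * expTurn (-(a * (round ((s : ℝ) * M / N) / M)))‖ ^ 2
        ≤ 1 / (L * M * N) * (Real.pi / M) ^ 2 * (a : ℝ) ^ 2 := by
    intro a _
    rw [norm_mul, norm_mul, norm_expTurn, mul_one, mul_pow, norm_div, norm_one, Complex.norm_real,
      Real.norm_of_nonneg (Real.sqrt_nonneg _), div_pow, Real.sq_sqrt (by positivity), one_pow,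
      mul_assoc (1 / ((L : ℝ) * M * N)), ← mul_pow]
    gcongr
    refine (norm_expTurn_sub_one_le _).trans ?_
    rw [abs_mul, abs_div, abs_of_pos hM', Nat.abs_cast]
    calc 2 * Real.pi * (a * (|δ| / M)) ≤ 2 * Real.pi * (a * (1 / 2 / M)) := by gcongr
      _ = Real.pi / M * a := by ring
  calc _ ≤ (M : ℝ) * ∑ a ∈ Finset.range (L * N),
          1 / (L * M * N) * (Real.pi / M) ^ 2 * (a : ℝ) ^ 2 := by
        gcongr with a ha
        exact hterm a ha
    _ ≤ M * (1 / (L * M * N) * (Real.pi / M) ^ 2 * (((L * N : ℕ) : ℝ) ^ 3 / 3)) := by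
        rw [← Finset.mul_sum]
        gcongr
        exact sum_range_sq_le _
    _ = _ := by
        rw [div_pow (Real.pi * L * N), mul_pow (M : ℝ), Real.sq_sqrt (by norm_num)]
        push_cast
        field_simp

/-! ### The tails -/

/-- Off the main part of the `i`-th bump, `k N / M` stays away from `i` modulo `N`. If `t ∉ Λ`, then
`|t| > M / (2 N) - 1 / 2`, and removing the rounding in `t` leaves a distance of more than
`M / (2 N) - 1`, that is `1 / 2 - N / M ≥ 7 / 16` after scaling by `N / M`. -/
theorem le_abs_of_not_mem_bump (N M : ℕ) (hN : 0 < N) (hM : 16 * N ≤ M) (i : Fin N) (k : ℤ)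
    (h : ¬ (deltaS N M k = (i : ℕ) ∧ deltaT N M k ∈ Lam N M)) (r : ℤ) :
    7 / 16 ≤ |(k : ℝ) * N / M - ((i : ℕ) + N * r)| := by
  by_contra! hlt
  apply h
  have hN' : (0 : ℝ) < N := by positivity
  have hM' : (16 : ℝ) * N ≤ M := by exact_mod_cast hM
  have hM0 : (0 : ℝ) < M := by linarith
  have hQ : deltaQuot N M k = (i : ℕ) + N * r := by
    rw [deltaQuot, round_eq_iff]
    rw [abs_lt] at hlt
    push_cast
    exact ⟨by linarith, by linarith⟩
  constructor
  · rw [deltaS, hQ, Int.add_mul_emod_self_left]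
    exact Int.emod_eq_of_lt (by positivity) (by exact_mod_cast i.isLt)
  · rw [mem_Lam, deltaT, hQ]
    have h1 := abs_sub_round ((((i : ℕ) + N * r : ℤ) : ℝ) * M / N)
    set p := round ((((i : ℕ) + N * r : ℤ) : ℝ) * M / N)
    have e : ((k - p : ℤ) : ℝ) = ((k : ℝ) * N / M - ((i : ℕ) + N * r)) * (M / N)
        + ((((i : ℕ) + N * r : ℤ) : ℝ) * M / N - p) := by
      push_cast
      field_simp
      ring
    have h2 : |((k : ℝ) * N / M - ((i : ℕ) + N * r)) * (M / N)| ≤ 7 / 16 * (M / N) := by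
      rw [abs_mul, abs_of_pos (div_pos hM0 hN')]
      gcongr
    have h3 : (16 : ℝ) ≤ M / N := (le_div_iff₀ hN').mpr hM'
    have h4 : (M : ℝ) / (2 * N) = 1 / 2 * (M / N) := by
      field_simp
    rw [e, h4]
    refine (abs_add_le _ _).trans ?_
    linarith

/-- Away from the centre of the `i`-th bump the geometric sum `A^i_k` is small. The hypothesis
excludes the junk value `1 / 0 = 0` on the right-hand side. -/
theorem norm_coeffA_le (N L M : ℕ) (hN : 0 < N) (hM : 0 < M) (i k : ℤ)
    (h : ∀ r : ℤ, (k : ℝ) * N / M - (i + N * r) ≠ 0) :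
    ‖coeffA N L M i k‖
      ≤ 1 / Real.sqrt (L * M * N) * (1 / |Real.sin (Real.pi * (k / M - i / N))|) := by
  have hN' : (N : ℝ) ≠ 0 := by positivity
  have hM' : (M : ℝ) ≠ 0 := by positivity
  rw [coeffA_eq, norm_mul, norm_div, norm_one, Complex.norm_real,
    Real.norm_of_nonneg (Real.sqrt_nonneg _)]
  gcongr
  refine norm_sum_expTurn_le _ _ fun h0 => ?_
  obtain ⟨r, hr⟩ := Real.sin_eq_zero_iff.mp h0
  apply h r
  have : (r : ℝ) = k / M - i / N := by
    rw [mul_comm] at hr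
    exact mul_left_cancel₀ Real.pi_ne_zero hr
  rw [this]
  field_simp
  ring

/-- Row sums of the matrix of tails: the points `k N / M - i` are spaced by `1` and avoid the
`7 / 16`-neighbourhood of `N ℤ`. -/
theorem sum_norm_coeffA_tail_row_le (N L M : ℕ) (hN : 0 < N) (hM : 16 * N ≤ M) (k : ℤ) :
    ∑ i : Fin N, ‖if ¬ (deltaS N M k = (i : ℕ) ∧ deltaT N M k ∈ Lam N M) then
        coeffA N L M (i : ℕ) k else 0‖
      ≤ 1 / Real.sqrt (L * M * N) * (N * (16 / 7 + Real.log (8 / 7 * N))) := by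
  have hN' : (0 : ℝ) < N := by positivity
  have hN1 : (1 : ℝ) ≤ N := by exact_mod_cast hN
  have hM0 : 0 < M := by omega
  have hd := fun i => le_abs_of_not_mem_bump N M hN hM i k
  simp_rw [apply_ite norm, norm_zero]
  rw [← Finset.sum_filter]
  have hs := sum_one_div_abs_sin_le
    (Finset.univ.filter fun i : Fin N => ¬ (deltaS N M k = (i : ℕ) ∧ deltaT N M k ∈ Lam N M))
    (fun i => -((i : ℕ) : ℤ)) N hN (k * N / M) (7 / 16) (by norm_num) (by linarith) ?_ ?_
  · have e : (N : ℝ) / (2 * (7 / 16)) = 8 / 7 * N := by ring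
    rw [e, one_div_div] at hs
    refine (Finset.sum_le_sum fun i hi => norm_coeffA_le N L M hN hM0 _ _ fun r h0 => ?_).trans ?_
    · have := hd i (Finset.mem_filter.mp hi).2 r
      rw [Int.cast_natCast] at h0
      rw [h0] at this
      norm_num at this
    · rw [← Finset.mul_sum]
      gcongr
      refine (Finset.sum_congr rfl fun i _ => ?_).trans_le hs
      congr 4
      push_cast
      field_simp
      ring
  · intro i _ j _ h
    have := Int.eq_zero_of_abs_lt_dvd h (by rw [abs_lt]; constructor <;> omega)
    exact Fin.ext (by omega)
  · intro i hi r
    refine (hd i (Finset.mem_filter.mp hi).2 r).trans_eq ?_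
    congr 1
    push_cast
    ring

/-- Column sums of the matrix of tails: the points `k - i M / N` are spaced by `1` and avoid the
neighbourhood of `M ℤ` of radius `7 M / (16 N) ≥ 7`. -/
theorem sum_norm_coeffA_tail_col_le (N L M : ℕ) (hN : 0 < N) (hM : 16 * N ≤ M) (i : Fin N) :
    ∑ k : Fin M, ‖if ¬ (deltaS N M (k : ℕ) = (i : ℕ) ∧ deltaT N M (k : ℕ) ∈ Lam N M) then
        coeffA N L M (i : ℕ) (k : ℕ) else 0‖
      ≤ 1 / Real.sqrt (L * M * N) * (M * (1 / 7 + Real.log (8 / 7 * N))) := by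
  have hN' : (0 : ℝ) < N := by positivity
  have hN1 : (1 : ℝ) ≤ N := by exact_mod_cast hN
  have hM0 : 0 < M := by omega
  have hM0' : (0 : ℝ) < M := by positivity
  have hM' : (16 : ℝ) * N ≤ M := by exact_mod_cast hM
  have hd := fun k : Fin M => le_abs_of_not_mem_bump N M hN hM i (k : ℕ)
  simp_rw [apply_ite norm, norm_zero]
  rw [← Finset.sum_filter]
  have hs := sum_one_div_abs_sin_le
    (Finset.univ.filter fun k : Fin M =>
      ¬ (deltaS N M (k : ℕ) = (i : ℕ) ∧ deltaT N M (k : ℕ) ∈ Lam N M))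
    (fun k => ((k : ℕ) : ℤ)) M hM0 (-((i : ℕ) * M / N)) (7 / 16 * (M / N)) (by positivity) ?_ ?_ ?_
  · have e : (M : ℝ) / (2 * (7 / 16 * (M / N))) = 8 / 7 * N := by
      field_simp
      norm_num
    have e2 : 1 / (7 / 16 * ((M : ℝ) / N)) ≤ 1 / 7 := by
      apply one_div_le_one_div_of_le (by norm_num)
      have : (16 : ℝ) ≤ M / N := (le_div_iff₀ hN').mpr hM'
      linarith
    rw [e] at hs
    refine (Finset.sum_le_sum fun k hk => norm_coeffA_le N L M hN hM0 _ _ fun r h0 => ?_).trans ?_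
    · have := hd k (Finset.mem_filter.mp hk).2 r
      rw [Int.cast_natCast (i : ℕ)] at h0
      rw [h0] at this
      norm_num at this
    · rw [← Finset.mul_sum]
      refine mul_le_mul_of_nonneg_left (le_trans ?_ (hs.trans ?_)) (by positivity)
      · refine (Finset.sum_congr rfl fun k _ => ?_).le
        congr 4
        push_cast
        field_simp
        ring
      · gcongr
  · have : (M : ℝ) / N ≤ M := div_le_self hM0'.le hN1
    linarith
  · intro k _ l _ h
    have := Int.eq_zero_of_abs_lt_dvd h (by rw [abs_lt]; constructor <;> omega)
    exact Fin.ext (by omega)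
  · intro k hk r
    have h := hd k (Finset.mem_filter.mp hk).2 r
    have e : (((k : ℕ) : ℤ) : ℝ) + -((i : ℕ) * M / N) - M * r
        = ((((k : ℕ) : ℤ) : ℝ) * N / M - ((i : ℕ) + N * r)) * (M / N) := by
      field_simp
      ring
    rw [e, abs_mul, abs_of_pos (div_pos hM0' hN')]
    gcongr

/-- The constants of the row and column sums fit under the claimed bound, because `log N ≥ 1` and
`π ^ 2 < 10`. -/
theorem tail_constant_le (N : ℕ) (hN : 3 ≤ N) :
    (16 / 7 + Real.log (8 / 7 * N)) * (1 / 7 + Real.log (8 / 7 * N))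
      ≤ (2 / Real.pi) ^ 2 * (22 * Real.log N ^ 2) := by
  have hN' : (3 : ℝ) ≤ N := by exact_mod_cast hN
  have hl : 1 ≤ Real.log N := by
    rw [Real.le_log_iff_exp_le (by linarith)]
    linarith [Real.exp_one_lt_d9]
  have h8 : Real.log (8 / 7 * N) ≤ 1 / 7 + Real.log N := by
    rw [Real.log_mul (by norm_num) (by linarith)]
    have := Real.log_le_sub_one_of_pos (x := 8 / 7) (by norm_num)
    linarith
  have h0 : 0 ≤ Real.log (8 / 7 * N) := Real.log_nonneg (by linarith)
  have hpi : (44 / 10 : ℝ) ≤ (2 / Real.pi) ^ 2 * 22 / 2 := by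
    rw [div_pow]
    have h1 : Real.pi ^ 2 < 10 := by
      have := Real.pi_lt_d2
      nlinarith [Real.pi_pos]
    have h2 : (4 / 10 : ℝ) ≤ 2 ^ 2 / Real.pi ^ 2 := by
      rw [div_le_div_iff₀ (by norm_num) (by positivity)]
      linarith
    linarith
  calc _ ≤ (16 / 7 + (1 / 7 + Real.log N)) * (1 / 7 + (1 / 7 + Real.log N)) := by gcongr
    _ ≤ 8 * Real.log N ^ 2 := by nlinarith
    _ ≤ 2 * (44 / 10) * Real.log N ^ 2 := by nlinarith
    _ ≤ 2 * ((2 / Real.pi) ^ 2 * 22 / 2) * Real.log N ^ 2 := by gcongr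
    _ = _ := by ring

end OddQFT

theorem theoremt (N L M : ℕ) (hN : Odd N) (hN13 : 13 ≤ N)
    (hL : ∃ l : ℕ, L = 2 ^ l) (hL16 : 16 ≤ L)
    (hM : ∃ m : ℕ, M = 2 ^ m) (hLM : L * N ≤ M)
    (u : OddQFT.Reg N) (hu : ‖u‖ = 1) :
    ‖OddQFT.output N L M u - OddQFT.qft N u ⊗ₜ[ℂ] OddQFT.bump N L M‖ ≤
      2 / Real.pi * Real.sqrt (22 * Real.log N ^ 2 / L + 32 * (N : ℝ) ^ 2 / (L * M)) +
        Real.pi * L * N / (M * Real.sqrt 3) := by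
  open OddQFT in
  have hN0 : 0 < N := by omega
  have hL0 : 0 < L := by omega
  have hM0 : 0 < M := lt_of_lt_of_le (Nat.mul_pos hL0 hN0) hLM
  have hM16 : 16 * N ≤ M := (Nat.mul_le_mul_right N hL16).trans hLM
  have hN' : (0 : ℝ) < N := by positivity
  have hL' : (0 : ℝ) < L := by positivity
  have hM' : (0 : ℝ) < M := by positivity
  have hnorm : ∑ s : Fin N, ‖qft N u s‖ ^ 2 = 1 := by rw [sum_norm_qft_sq N hN0, hu, one_pow]
  have hex : ∀ k : Fin M, ∃ s : Fin N, ((s : ℕ) : ℤ) = deltaS N M (k : ℕ) := by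
    intro k
    obtain ⟨⟨h1, h2⟩, -⟩ := delta_range N M hN0 hM0 (k : ℕ)
    exact ⟨⟨(deltaS N M (k : ℕ)).toNat, by omega⟩, Int.toNat_of_nonneg h1⟩
  choose σ hσ using hex
  -- `w` is the state before the division step, `w₀` the preimage of the approximation,
  -- `w₁` the rounding error and `w₂` the contribution of the tails
  set w : Reg M := qft M (multiply N L M ((qft L).lTensor (Reg N) (u ⊗ₜ[ℂ] ket L 0))) with hw
  set w₀ : Reg M := WithLp.toLp 2 fun k => if deltaT N M (k : ℕ) ∈ Lam N M then
    qft N u (σ k) * coeffA N L M 0 (deltaT N M (k : ℕ)) else 0 with hw₀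
  set w₁ : Reg M := WithLp.toLp 2 fun k => if deltaT N M (k : ℕ) ∈ Lam N M then
    qft N u (σ k) * (coeffA N L M (deltaS N M (k : ℕ)) (k : ℕ)
      - coeffA N L M 0 (deltaT N M (k : ℕ))) else 0 with hw₁
  set w₂ : Reg M := WithLp.toLp 2 fun k => ∑ i : Fin N, qft N u i *
    (if ¬ (deltaS N M (k : ℕ) = (i : ℕ) ∧ deltaT N M (k : ℕ) ∈ Lam N M) then
      coeffA N L M (i : ℕ) (k : ℕ) else 0) with hw₂
  have hsum : w - w₀ = w₂ + w₁ := by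
    rw [sub_eq_iff_eq_add]
    ext k
    rw [PiLp.add_apply, PiLp.add_apply, hw, qft_multiply_apply N L M hN0 hL0 hLM]
    have h1 : ∑ i : Fin N, qft N u i * coeffA N L M (i : ℕ) (k : ℕ)
        = w₂ k + ∑ i : Fin N, if i = σ k ∧ deltaT N M (k : ℕ) ∈ Lam N M then
          qft N u i * coeffA N L M (i : ℕ) (k : ℕ) else 0 := by
      rw [hw₂, ← Finset.sum_add_distrib]
      refine Finset.sum_congr rfl fun i _ => ?_
      have : deltaS N M (k : ℕ) = (i : ℕ) ↔ i = σ k := by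
        rw [← hσ, Fin.ext_iff]
        omega
      simp only [this]
      split_ifs <;> simp_all
    rw [h1, add_assoc]
    congr 1
    rw [hw₀, hw₁]
    by_cases ht : deltaT N M (k : ℕ) ∈ Lam N M
    · simp only [ht, and_true, if_true, Finset.sum_ite_eq', Finset.mem_univ, ← hσ]
      ring
    · simp [ht]
  have happ : qft N u ⊗ₜ[ℂ] bump N L M = Delta N M w₀ :=
    (Delta_eq_tmul_sum N M hN hM0 (qft N u) (coeffA N L M 0) σ hσ).symm
  have hout : output N L M u = Delta N M w := rfl
  rw [hout, happ, ← map_sub, norm_Delta N M hN0 hM0, hsum]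
  refine (norm_add_le _ _).trans (add_le_add ?_ ?_)
  · have hR0 : 0 ≤ 1 / Real.sqrt (L * M * N) * (N * (16 / 7 + Real.log (8 / 7 * N))) := by
      have : 0 ≤ Real.log (8 / 7 * N) := by
        refine Real.log_nonneg ?_
        have : (13 : ℝ) ≤ N := by exact_mod_cast hN13
        linarith
      positivity
    have h := schur_test Finset.univ Finset.univ (fun (k : Fin M) (i : Fin N) =>
      if ¬ (deltaS N M (k : ℕ) = (i : ℕ) ∧ deltaT N M (k : ℕ) ∈ Lam N M) then
        coeffA N L M (i : ℕ) (k : ℕ) else 0) (fun i => qft N u i) _ _ hR0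
      (fun k _ => sum_norm_coeffA_tail_row_le N L M hN0 hM16 (k : ℕ))
      (fun i _ => sum_norm_coeffA_tail_col_le N L M hN0 hM16 i)
    rw [hnorm, mul_one] at h
    have h2 : ‖w₂‖ ^ 2 ≤ (2 / Real.pi * Real.sqrt (22 * Real.log N ^ 2 / L
        + 32 * (N : ℝ) ^ 2 / (L * M))) ^ 2 := by
      rw [EuclideanSpace.norm_sq_eq]
      refine h.trans ?_
      rw [mul_pow (2 / Real.pi), Real.sq_sqrt (by positivity)]
      have hsq : Real.sqrt (L * M * N) * Real.sqrt (L * M * N) = L * M * N :=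
        Real.mul_self_sqrt (by positivity)
      calc _ = (L * M * N) / (Real.sqrt (L * M * N) * Real.sqrt (L * M * N)) *
            ((16 / 7 + Real.log (8 / 7 * N)) * (1 / 7 + Real.log (8 / 7 * N))) / L := by
            field_simp
        _ = (16 / 7 + Real.log (8 / 7 * N)) * (1 / 7 + Real.log (8 / 7 * N)) / L := by
            rw [hsq, div_self (by positivity), one_mul]
        _ ≤ (2 / Real.pi) ^ 2 * (22 * Real.log N ^ 2) / L := by
            exact div_le_div_of_nonneg_right (tail_constant_le N (by omega)) hL'.le
        _ = (2 / Real.pi) ^ 2 * (22 * Real.log N ^ 2 / L) := by ring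
        _ ≤ _ := by
            gcongr
            exact le_add_of_nonneg_right (by positivity)
    exact (sq_le_sq₀ (norm_nonneg _) (by positivity)).mp h2
  · refine (sq_le_sq₀ (norm_nonneg _) (by positivity)).mp ?_
    rw [EuclideanSpace.norm_sq_eq]
    -- for each `s`, the sum over the `k` with first component `s` is extended to all `k`
    let g : Fin N → ℕ → ℂ := fun s k => ∑ a ∈ Finset.range (L * N),
      (1 / (Real.sqrt (L * M * N) : ℂ)) *
        (expTurn (a * ((round ((((s : ℕ) : ℤ) : ℝ) * M / N) - (((s : ℕ) : ℤ) : ℝ) * M / N) / M))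
          - 1) * expTurn (-(a * (round ((((s : ℕ) : ℤ) : ℝ) * M / N) / M)))
          * expTurn (k * (a / M))
    have hterm : ∀ k : Fin M, ‖w₁ k‖ ^ 2 ≤ ∑ s : Fin N, ‖qft N u s‖ ^ 2 * ‖g s k‖ ^ 2 := by
      intro k
      have h1 : ‖w₁ k‖ ^ 2 ≤ ‖qft N u (σ k)‖ ^ 2 * ‖g (σ k) k‖ ^ 2 := by
        rw [hw₁]
        simp only
        split_ifs
        · rw [coeffA_sub_coeffA N L M hN0 hM0, norm_mul, mul_pow, ← hσ]
          exact le_rfl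
        · rw [norm_zero, zero_pow two_ne_zero]
          positivity
      exact h1.trans (Finset.single_le_sum (f := fun s => ‖qft N u s‖ ^ 2 * ‖g s k‖ ^ 2)
        (fun s _ => by positivity) (Finset.mem_univ _))
    calc ∑ k : Fin M, ‖w₁ k‖ ^ 2
        ≤ ∑ k : Fin M, ∑ s : Fin N, ‖qft N u s‖ ^ 2 * ‖g s k‖ ^ 2 :=
          Finset.sum_le_sum fun k _ => hterm k
      _ = ∑ s : Fin N, ‖qft N u s‖ ^ 2 * ∑ k ∈ Finset.range M, ‖g s k‖ ^ 2 := by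
          rw [Finset.sum_comm]
          simp_rw [Finset.sum_range, Finset.mul_sum]
      _ ≤ ∑ s : Fin N, ‖qft N u s‖ ^ 2 * (Real.pi * L * N / (M * Real.sqrt 3)) ^ 2 := by
          gcongr with s _
          exact sum_norm_coeffA_sub_sq_le N L M hN0 hL0 hLM _
      _ = _ := by rw [← Finset.sum_mul, hnorm, one_mul]
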